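/- All rings are commutative with identity. Let $T$ be an integral domain and let $R\subset T$ be a minimal ring extension, i.e. $R$ is a proper subring of $T$ and there is no ring $S$ with $R\subsetneq S\subsetneq T$. For a prime ideal $P$ of $R$ put $T_P:=T_{R\setminus P}$. Let $J$ be the crucial maximal ideal of the extension, i.e. the (unique) maximal ideal $J$ of $R$ for which the canonical map $R_J\to T_J$ is not an isomorphism. Let $(R:T)=\{s\in T : sT\subseteq R\}$ be the conductor. Then $(R:T)=0$ if and only if one of the following holds: (a) $R$ is a field and $T$ is a minimal field extension of $R$ (i.e. $T$ is a field, $R\neq T$, and there is no field strictly between $R$ and $T$); (b) $R_J$ is a valuation ring of altitude (Krull dimension) one and $T_J$ is its quotient field. -/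

import Mathlib

namespace MinimalExt

/-- `R ⊂ T` is a minimal ring extension: `R` is a proper subring of `T`
and there is no ring strictly between `R` and `T`. -/
def IsMinimalRingExtension {T : Type*} [CommRing T] (R : Subring T) : Prop :=
  R < ⊤ ∧ ∀ S : Subring T, ¬ (R < S ∧ S < ⊤)

/-- `R ⊂ T` is a minimal field extension: `R` and `T` are fields, `R ≠ T`,
and there is no field strictly between `R` and `T`. -/
def IsMinimalFieldExtension {T : Type*} [CommRing T] (R : Subring T) : Prop :=
  IsField R ∧ IsField T ∧ R < ⊤ ∧ ∀ S : Subring T, IsField S → ¬ (R < S ∧ S < ⊤)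

/-- The conductor `(R : T) = {s ∈ T | s T ⊆ R}`, an ideal of `T`. -/
def conductor {T : Type*} [CommRing T] (R : Subring T) : Ideal T where
  carrier := {s | ∀ t : T, s * t ∈ R}
  zero_mem' := fun t => by simp [R.zero_mem]
  add_mem' := fun {a b} ha hb t => by
    rw [add_mul]; exact R.add_mem (ha t) (hb t)
  smul_mem' := fun c s hs t => by
    have h := hs (c * t)
    rwa [smul_eq_mul, mul_comm c s, mul_assoc]

/-- The localization `T_J = T_{R \ J}` of `T` at the (image in `T` of the) multiplicative
set `R \ J`. It is an algebra over `R_J` through the canonical map `R_J → T_J` that the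
inclusion `R ⊂ T` induces. -/
abbrev LocExt {T : Type*} [CommRing T] (R : Subring T) (J : Ideal R) [J.IsPrime] : Type _ :=
  Localization (Algebra.algebraMapSubmonoid T J.primeCompl)

/-- The maximal ideal `J` of `R` is crucial for `R ⊂ T`: the canonical map `R_J → T_J` is not
an isomorphism. -/
def IsCrucial {T : Type*} [CommRing T] (R : Subring T) (J : Ideal R) [J.IsMaximal] : Prop :=
  ¬ Function.Bijective (algebraMap (Localization.AtPrime J) (LocExt R J))

end MinimalExt

/-!
The extension `R_J → T_J` is again minimal and its conductor contracts to that of `R ⊂ T`, so the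
theorem reduces to a local base ring. If `R` is a field, the conductor vanishes because it is a
proper ideal of `R`, and minimality makes `T` integral over `R`, hence a field.

Now let `A ⊂ B` be minimal with `A` a local domain that is not a field, and with zero conductor.
An integral minimal extension is finite, and by Nakayama its conductor contains the Jacobson
radical; hence `A` is integrally closed in `B`. Every `x ∈ B` is a root of a polynomial over `A`
with a unit coefficient, since `A[x²]` is `A` or `B`. Seidenberg's `u, u⁻¹` lemma then puts `x` or
`x⁻¹` in `A`, so `A` is a valuation ring with fraction field `B`. It has dimension one because its
localizations lie between `A` and `B`. Conversely, a nonzero element of the conductor would be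
invertible in `B = Frac A`, forcing `A = B`.
-/

namespace MinimalExt

open Polynomial
open scoped nonZeroDivisors

variable {A B : Type*} [CommRing A] [CommRing B] [Algebra A B]

section Conductor

variable (A B) in
/-- The conductor of an `A`-algebra `B`, as an ideal of `A`: the annihilator of the `A`-module
`B / A`. Unlike `MinimalExt.conductor` it does not ask `A` to be a subring of `B`, so that it can
be formed for `R_J → T_J`. -/
def algebraConductor : Ideal A :=
  (⊥ : Subalgebra A B).toSubmodule.colon Set.univ

theorem mem_algebraConductor {a : A} :
    a ∈ algebraConductor A B ↔ ∀ b : B, a • b ∈ (⊥ : Subalgebra A B) := by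
  simp [algebraConductor, Submodule.mem_colon]

theorem bot_eq_top_of_mem_algebraConductor_of_isUnit {a : A} (ha : a ∈ algebraConductor A B)
    (hu : IsUnit (algebraMap A B a)) : (⊥ : Subalgebra A B) = ⊤ := by
  obtain ⟨z, hz⟩ := hu.exists_right_inv
  refine eq_top_iff.mpr fun b _ => ?_
  have hb : a • (z * b) = b := by rw [Algebra.smul_def, ← mul_assoc, hz, one_mul]
  exact hb ▸ mem_algebraConductor.mp ha (z * b)

theorem algebraConductor_eq_bot_of_isField [Nontrivial (Subalgebra A B)] (hA : IsField A) :
    algebraConductor A B = ⊥ := by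
  let := hA.toField
  refine (Ideal.eq_bot_or_top _).resolve_right fun htop => bot_ne_top (α := Subalgebra A B) ?_
  exact bot_eq_top_of_mem_algebraConductor_of_isUnit (htop ▸ Submodule.mem_top : (1 : A) ∈ _)
    (by rw [map_one]; exact isUnit_one)

theorem algebraMap_injective_of_algebraConductor_eq_bot (h : algebraConductor A B = ⊥) :
    Function.Injective (algebraMap A B) := by
  refine (injective_iff_map_eq_zero _).mpr fun a ha => ?_
  have hmem : a ∈ algebraConductor A B := mem_algebraConductor.mpr fun b => by
    rw [Algebra.smul_def, ha, zero_mul]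
    exact zero_mem _
  rwa [h] at hmem

theorem algebraConductor_eq_bot_of_isFractionRing [IsFractionRing A B] [IsDomain A]
    [Nontrivial (Subalgebra A B)] : algebraConductor A B = ⊥ := by
  refine eq_bot_iff.mpr fun a ha => by_contra fun ha0 => bot_ne_top (α := Subalgebra A B) ?_
  exact bot_eq_top_of_mem_algebraConductor_of_isUnit ha
    (IsLocalization.map_units B (⟨a, mem_nonZeroDivisors_of_ne_zero ha0⟩ : A⁰))

end Conductor

section UnitCoefficient

theorem isIntegral_of_isUnit_leadingCoeff {x : B} {f : A[X]} (hf : aeval x f = 0)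
    (hu : IsUnit f.leadingCoeff) : IsIntegral A x := by
  obtain ⟨c, hc⟩ := hu.exists_left_inv
  have h := (isIntegral_leadingCoeff_smul f x hf).smul c
  rwa [smul_smul, hc, one_smul] at h

/-- If `c xᵐ⁺¹` is the leading term of `f(x)` and `c x = a ∈ A`, that term can be
rewritten as `a xᵐ`. -/
theorem exists_natDegree_le_of_algebraMap_eq_leadingCoeff_smul {x : B} {f : A[X]} {m : ℕ} {a : A}
    (hf : aeval x f = 0) (hm : f.natDegree = m + 1)
    (ha : algebraMap A B a = f.leadingCoeff • x) :
    ∃ g : A[X], aeval x g = 0 ∧ g.natDegree ≤ m ∧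
      ∀ n ≠ f.natDegree, g.coeff n = f.coeff n + if n = m then a else 0 := by
  refine ⟨f.eraseLead + C a * X ^ m, ?_, ?_, fun n hn => ?_⟩
  · rw [Algebra.smul_def] at ha
    simp [← self_sub_monomial_natDegree_leadingCoeff, hf, hm, pow_succ', ha, mul_assoc]
  · have hlead : f.eraseLead.natDegree ≤ m := f.eraseLead_natDegree_le.trans (by lia)
    compute_degree!
  · simp [eraseLead_coeff, hn]

/-- Seidenberg's `u, u⁻¹` lemma: the degree of `f` drops until its leading coefficient `c`, or
the element `c x` of `A`, is a unit. -/
theorem exists_algebraMap_eq_or_mul_eq_one_of_isUnit_coeff [IsLocalRing A]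
    [IsIntegrallyClosedIn A B] {x : B} {f : A[X]} (hf : aeval x f = 0) {n : ℕ}
    (hn : IsUnit (f.coeff n)) :
    (∃ a, algebraMap A B a = x) ∨ ∃ a, algebraMap A B a * x = 1 := by
  induction hd : f.natDegree using Nat.strong_induction_on generalizing f with | h d ih
  by_cases hlead : IsUnit f.leadingCoeff
  · exact Or.inl (IsIntegrallyClosedIn.isIntegral_iff.mp
      (isIntegral_of_isUnit_leadingCoeff hf hlead))
  have hnd : n ≠ f.natDegree := by
    rintro rfl
    exact hlead hn
  have hn_le : n ≤ f.natDegree := le_natDegree_of_ne_zero hn.ne_zero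
  obtain ⟨m, rfl⟩ : ∃ m, d = m + 1 := Nat.exists_eq_succ_of_ne_zero (by lia)
  obtain ⟨a, ha⟩ := IsIntegrallyClosedIn.isIntegral_iff.mp (isIntegral_leadingCoeff_smul f x hf)
  by_cases hau : IsUnit a
  · obtain ⟨c, hc⟩ := hau.exists_left_inv
    refine Or.inr ⟨c * f.leadingCoeff, ?_⟩
    rw [map_mul, mul_assoc, ← Algebra.smul_def f.leadingCoeff, ← ha, ← map_mul, hc, map_one]
  obtain ⟨g, hg, hgm, hcoeff⟩ :=
    exists_natDegree_le_of_algebraMap_eq_leadingCoeff_smul hf hd ha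
  refine ih g.natDegree (by lia) hg ?_ rfl
  rw [hcoeff n hnd]
  split_ifs
  · by_contra hsum
    have := IsLocalRing.nonunits_add (b := -a) hsum (by simpa using hau)
    exact this (by simpa using hn)
  · simpa using hn

end UnitCoefficient

section Minimal

variable [IsSimpleOrder (Subalgebra A B)]

/-- Compare `A[x²]` with `A` and with `B`. -/
theorem exists_aeval_eq_zero_and_isUnit_coeff (x : B) :
    ∃ f : A[X], aeval x f = 0 ∧ ∃ n, IsUnit (f.coeff n) := by
  obtain h | h := eq_bot_or_eq_top (Algebra.adjoin A {x ^ 2})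
  · obtain ⟨a, ha⟩ : x ^ 2 ∈ (⊥ : Subalgebra A B) := h ▸ Algebra.self_mem_adjoin_singleton A _
    exact ⟨X ^ 2 - C a, by simpa [sub_eq_zero] using ha.symm, 2, by simp⟩
  · have hx : x ∈ Algebra.adjoin A {x ^ 2} := h ▸ Algebra.mem_top
    rw [Algebra.adjoin_singleton_eq_range_aeval] at hx
    obtain ⟨p, hp⟩ := hx
    refine ⟨expand A 2 p - X, ?_, 1, ?_⟩
    · simpa [expand_aeval, sub_eq_zero] using hp
    · simp [coeff_expand two_pos]

theorem exists_algebraMap_eq_or_mul_eq_one [IsLocalRing A] [IsIntegrallyClosedIn A B] (x : B) :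
    (∃ a, algebraMap A B a = x) ∨ ∃ a, algebraMap A B a * x = 1 := by
  obtain ⟨f, hf, n, hn⟩ := exists_aeval_eq_zero_and_isUnit_coeff (A := A) x
  exact exists_algebraMap_eq_or_mul_eq_one_of_isUnit_coeff hf hn

theorem isIntegral_of_isField (hA : IsField A) : Algebra.IsIntegral A B := by
  refine ⟨fun x => ?_⟩
  obtain ⟨f, hf, n, hn⟩ := exists_aeval_eq_zero_and_isUnit_coeff (A := A) x
  let := hA.toField
  have hf0 : f ≠ 0 := by
    rintro rfl
    exact hn.ne_zero (coeff_zero n)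
  exact isIntegral_of_isUnit_leadingCoeff hf (leadingCoeff_ne_zero.mpr hf0).isUnit

theorem finite_of_isIntegral [Algebra.IsIntegral A B] : Module.Finite A B := by
  obtain ⟨x, -, hx⟩ := SetLike.exists_of_lt (bot_lt_top (α := Subalgebra A B))
  have hadj : Algebra.adjoin A {x} = ⊤ := (eq_bot_or_eq_top _).resolve_left fun h =>
    hx (h ▸ Algebra.self_mem_adjoin_singleton A x)
  refine ⟨?_⟩
  rw [← Algebra.top_toSubmodule, ← hadj]
  exact (Algebra.IsIntegral.isIntegral x).fg_adjoin_singleton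

theorem exists_eq_algebraMap_add_smul {a : A} (ha : a ∉ algebraConductor A B) (b : B) :
    ∃ (c : A) (d : B), b = algebraMap A B c + a • d := by
  let I : Ideal B := Ideal.span {algebraMap A B a}
  -- `S` is the subring `A + aB` of `B`.
  let S : Subalgebra A B := (⊥ : Subalgebra A (B ⧸ I)).comap (Ideal.Quotient.mkₐ A I)
  have hS : S = ⊤ := (eq_bot_or_eq_top S).resolve_left fun hbot =>
    ha (mem_algebraConductor.mpr fun d => hbot ▸ ⟨0, by
      rw [map_zero, Algebra.smul_def]
      exact (Ideal.Quotient.eq_zero_iff_mem.mpr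
        (I.mul_mem_right d (Ideal.mem_span_singleton_self _))).symm⟩)
  obtain ⟨c, hc⟩ : b ∈ S := hS ▸ Algebra.mem_top
  obtain ⟨d, hd⟩ := Ideal.mem_span_singleton'.mp (Ideal.Quotient.eq.mp hc.symm)
  refine ⟨c, d, ?_⟩
  rw [Algebra.smul_def, mul_comm, hd, add_sub_cancel]

theorem jacobson_le_algebraConductor [Module.Finite A B] :
    Ideal.jacobson ⊥ ≤ algebraConductor A B := by
  intro a ha
  by_contra hac
  have hle : (⊤ : Submodule A B) ≤ (⊥ : Subalgebra A B).toSubmodule := by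
    refine Submodule.le_of_le_smul_of_le_jacobson_bot Module.Finite.fg_top le_rfl fun b _ => ?_
    obtain ⟨c, d, rfl⟩ := exists_eq_algebraMap_add_smul hac b
    exact Submodule.add_mem_sup (Subalgebra.algebraMap_mem ⊥ c)
      (Submodule.smul_mem_smul ha Submodule.mem_top)
  exact bot_ne_top (top_le_iff.mp hle : (⊥ : Subalgebra A B) = ⊤)

theorem isIntegrallyClosedIn_of_algebraConductor_eq_bot [IsLocalRing A] (hA : ¬ IsField A)
    (h : algebraConductor A B = ⊥) : IsIntegrallyClosedIn A B := by
  refine (IsIntegrallyClosedIn.integralClosure_eq_bot_iff B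
    (algebraMap_injective_of_algebraConductor_eq_bot h)).mp ?_
  refine (eq_bot_or_eq_top _).resolve_right fun htop => hA ?_
  have : Algebra.IsIntegral A B := integralClosure_eq_top_iff.mp htop
  have : Module.Finite A B := finite_of_isIntegral
  refine IsLocalRing.isField_iff_maximalIdeal_eq.mpr (eq_bot_iff.mpr ?_)
  rw [← h]
  exact (IsLocalRing.maximalIdeal_le_jacobson ⊥).trans jacobson_le_algebraConductor

theorem isFractionRing_of_algebraConductor_eq_bot [IsDomain A] [IsLocalRing A]
    [IsIntegrallyClosedIn A B] (h : algebraConductor A B = ⊥) : IsFractionRing A B := by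
  have hinj := algebraMap_injective_of_algebraConductor_eq_bot h
  refine ⟨fun a => ?_, fun b => ?_, fun {a a'} haa' => ⟨1, by rw [hinj haa']⟩⟩
  · obtain ⟨b, hb⟩ : ∃ b : B, (a : A) • b ∉ (⊥ : Subalgebra A B) := by
      simpa [h, mem_algebraConductor] using
        mt mem_algebraConductor.mpr (h ▸ nonZeroDivisors.ne_zero a.2 : (a : A) ∉ _)
    obtain ⟨c, hc⟩ := (exists_algebraMap_eq_or_mul_eq_one _).resolve_left hb
    refine .of_mul_eq_one (algebraMap A B c * b) ?_
    rw [← hc, Algebra.smul_def]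
    ring
  · obtain ⟨c, rfl⟩ | ⟨c, hc⟩ := exists_algebraMap_eq_or_mul_eq_one (A := A) b
    · exact ⟨(c, 1), by simp⟩
    · have : Nontrivial B := hinj.nontrivial
      have hc0 : c ≠ 0 := by
        rintro rfl
        simp at hc
      exact ⟨(1, ⟨c, mem_nonZeroDivisors_of_ne_zero hc0⟩), by simpa [mul_comm] using hc⟩

theorem valuationRing_of_isFractionRing [IsDomain A] [IsLocalRing A] [IsIntegrallyClosedIn A B]
    [IsFractionRing A B] : ValuationRing A := by
  let := IsFractionRing.toField A (K := B)
  refine (ValuationRing.iff_isInteger_or_isInteger A B).mpr fun x => ?_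
  refine (exists_algebraMap_eq_or_mul_eq_one (A := A) x).imp id ?_
  rintro ⟨a, ha⟩
  exact ⟨a, eq_inv_of_mul_eq_one_left ha⟩

/-- For a nonzero prime `P`, the localization `A_P ⊂ Frac A` omits the inverses of the elements
of `P`, so it is `A`. -/
theorem krullDimLE_one_of_isFractionRing [IsDomain A] [IsFractionRing A B] :
    Ring.KrullDimLE 1 A := by
  refine .mk₁' fun P hP0 hP => ?_
  obtain ⟨p, hpP, hp0⟩ := P.ne_bot_iff.mp hP0
  let S := Localization.subalgebra B P.primeCompl P.primeCompl_le_nonZeroDivisors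
  have hS : S = ⊥ := (eq_bot_or_eq_top S).resolve_right fun htop => by
    obtain ⟨a, s, hs, has⟩ :
        IsLocalization.mk' B 1 (⟨p, mem_nonZeroDivisors_of_ne_zero hp0⟩ : A⁰) ∈ S :=
      htop ▸ Algebra.mem_top
    rw [IsLocalization.mk'_eq_iff_eq, mul_one] at has
    have hsp : s = p * a := IsFractionRing.injective A B has
    exact hs (hsp ▸ P.mul_mem_right a hpP)
  refine Ideal.isMaximal_iff.mpr ⟨P.one_notMem, fun I s _ hsP hsI => ?_⟩
  have hs : s ∈ A⁰ := P.primeCompl_le_nonZeroDivisors hsP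
  obtain ⟨a, ha⟩ : IsLocalization.mk' B 1 (⟨s, hs⟩ : A⁰) ∈ (⊥ : Subalgebra A B) :=
    hS ▸ ⟨1, s, hsP, rfl⟩
  have has : a * s = 1 := IsFractionRing.injective A B (by
    rw [map_mul]
    exact IsLocalization.eq_mk'_iff_mul_eq.mp ha)
  exact has ▸ I.mul_mem_left a hsI

theorem ringKrullDim_eq_one_of_isFractionRing [IsDomain A] [IsFractionRing A B] :
    ringKrullDim A = 1 := by
  have hle := Ring.krullDimLE_iff.mp (krullDimLE_one_of_isFractionRing (A := A) (B := B))
  have hpos : 0 < ringKrullDim A := lt_of_not_ge fun hdim => by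
    have : Ring.KrullDimLE 0 A := Ring.krullDimLE_iff.mpr hdim
    refine bot_ne_top (α := Subalgebra A B) ?_
    exact (Algebra.surjective_algebraMap_iff.mp
      (IsFractionRing.surjective_iff_isField.mpr Ring.KrullDimLE.isField_of_isDomain)).symm
  exact le_antisymm hle (Order.succ_le_of_lt hpos)

theorem algebraConductor_eq_bot_iff_of_isLocalRing [IsDomain A] [IsLocalRing A]
    (hA : ¬ IsField A) : algebraConductor A B = ⊥ ↔
      ValuationRing A ∧ ringKrullDim A = 1 ∧ IsFractionRing A B := by
  constructor
  · intro h
    have := isIntegrallyClosedIn_of_algebraConductor_eq_bot hA h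
    have := isFractionRing_of_algebraConductor_eq_bot h
    exact ⟨valuationRing_of_isFractionRing (B := B),
      ringKrullDim_eq_one_of_isFractionRing (B := B), this⟩
  · rintro ⟨-, -, _⟩
    exact algebraConductor_eq_bot_of_isFractionRing

end Minimal

section Localization

variable (M : Submonoid A) (A' B' : Type*) [CommRing A'] [CommRing B'] [Algebra A A']
  [Algebra B B'] [Algebra A' B'] [Algebra A B'] [IsScalarTower A A' B'] [IsScalarTower A B B']
  [IsLocalization M A'] [IsLocalization (Algebra.algebraMapSubmonoid B M) B']

variable (A B) in
/-- The contraction to `B` of a subalgebra of an algebra `B'` over `B`. -/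
abbrev contraction (S : Subalgebra A' B') : Subalgebra A B :=
  (S.restrictScalars A).comap (IsScalarTower.toAlgHom A B B')

include M in
theorem exists_isUnit_smul_eq_algebraMap (y : B') :
    ∃ (u : A') (b : B), IsUnit u ∧ u • y = algebraMap B B' b := by
  obtain ⟨⟨b, _, m, hm, rfl⟩, hb⟩ := IsLocalization.surj (Algebra.algebraMapSubmonoid B M) y
  refine ⟨algebraMap A A' m, b, IsLocalization.map_units A' (⟨m, hm⟩ : M), ?_⟩
  rw [← hb, algebraMap_smul, Algebra.smul_def, mul_comm, IsScalarTower.algebraMap_apply A B B']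

include M in
theorem contraction_injective : Function.Injective (contraction A B A' B') := by
  intro S S' h
  ext y
  obtain ⟨u, b, hu, hb⟩ := exists_isUnit_smul_eq_algebraMap (B := B) M A' B' y
  have mem_iff (S : Subalgebra A' B') : y ∈ S ↔ b ∈ contraction A B A' B' S := by
    rw [← Subalgebra.mem_toSubmodule, ← S.toSubmodule.smul_mem_iff_of_isUnit hu, hb]
    rfl
  rw [mem_iff, mem_iff, h]

variable [IsSimpleOrder (Subalgebra A B)] [Nontrivial (Subalgebra A' B')]

include M in
theorem contraction_bot : contraction A B A' B' ⊥ = ⊥ :=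
  (eq_bot_or_eq_top _).resolve_right fun h => bot_ne_top (contraction_injective M A' B' h)

include M B in
theorem isSimpleOrder_subalgebra_of_isLocalization : IsSimpleOrder (Subalgebra A' B') where
  eq_bot_or_eq_top S := by
    have hinj : Function.Injective (contraction A B A' B') := contraction_injective M A' B'
    exact (eq_bot_or_eq_top (contraction A B A' B' S)).imp
      (fun h => hinj (h.trans (contraction_bot M A' B').symm)) fun h => hinj h

include M in
theorem comap_algebraConductor :
    (algebraConductor A' B').comap (algebraMap A A') = algebraConductor A B := by
  have mem_bot (a : A) (b : B) : a • b ∈ (⊥ : Subalgebra A B) ↔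
      algebraMap A A' a • algebraMap B B' b ∈ (⊥ : Subalgebra A' B') := by
    rw [← contraction_bot M A' B', algebraMap_smul,
      ← IsScalarTower.coe_toAlgHom' A B B', ← map_smul]
    rfl
  ext a
  rw [Ideal.mem_comap, mem_algebraConductor, mem_algebraConductor]
  refine ⟨fun h b => (mem_bot a b).mpr (h _), fun h y => ?_⟩
  obtain ⟨u, b, hu, hb⟩ := exists_isUnit_smul_eq_algebraMap (B := B) M A' B' y
  rw [← Subalgebra.mem_toSubmodule, ← Submodule.smul_mem_iff_of_isUnit _ hu, smul_comm, hb]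
  exact (mem_bot a b).mp (h b)

include M in
theorem algebraConductor_eq_bot_iff_of_isLocalization (hM : M ≤ A⁰) :
    algebraConductor A' B' = ⊥ ↔ algebraConductor A B = ⊥ := by
  rw [← comap_algebraConductor M A' B']
  constructor
  · intro h
    rw [h]
    exact Ideal.comap_bot_of_injective _ (IsLocalization.injective A' hM)
  · intro h
    rw [← IsLocalization.map_under M A' (algebraConductor A' B'), Ideal.under_def, h, Ideal.map_bot]

end Localization

section Subring

variable {T : Type*} [CommRing T] {R : Subring T}

theorem mem_bot_subalgebra_iff {t : T} : t ∈ (⊥ : Subalgebra R T) ↔ t ∈ R := by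
  rw [Algebra.mem_bot]
  exact Set.ext_iff.mp Subtype.range_val t

theorem conductor_eq_bot_iff : conductor R = ⊥ ↔ algebraConductor R T = ⊥ := by
  have mem_iff (r : R) : r ∈ algebraConductor R T ↔ (r : T) ∈ conductor R :=
    mem_algebraConductor.trans (forall_congr' fun _ => mem_bot_subalgebra_iff)
  simp only [eq_bot_iff, SetLike.le_def, mem_iff]
  constructor
  · exact fun h r hr => Subtype.ext (h hr)
  · intro h s hs
    have hsR : s ∈ R := by simpa using hs 1
    exact congrArg Subtype.val (h (x := ⟨s, hsR⟩) hs)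

theorem IsMinimalRingExtension.isSimpleOrder_subalgebra (hRT : IsMinimalRingExtension R) :
    IsSimpleOrder (Subalgebra R T) where
  exists_pair_ne := ⟨⊥, ⊤, fun h => hRT.1.not_ge fun _ _ =>
    mem_bot_subalgebra_iff.mp (h ▸ Algebra.mem_top)⟩
  eq_bot_or_eq_top S := by
    by_contra! hS
    refine hRT.2 S.toSubring ⟨⟨fun r hr => S.algebraMap_mem ⟨r, hr⟩, fun h => ?_⟩,
      lt_top_iff_ne_top.mpr fun h => ?_⟩
    · exact hS.1 (eq_bot_iff.mpr fun s hs => mem_bot_subalgebra_iff.mpr (h hs))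
    · exact hS.2 (eq_top_iff.mpr fun t _ => (h ▸ Subring.mem_top t : t ∈ S.toSubring))

theorem IsMinimalRingExtension.isMinimalFieldExtension [IsDomain T]
    (hRT : IsMinimalRingExtension R) (hR : IsField R) : IsMinimalFieldExtension R := by
  have := hRT.isSimpleOrder_subalgebra
  have : Algebra.IsIntegral R T := isIntegral_of_isField hR
  exact ⟨hR, isField_of_isIntegral_of_isField' hR, hRT.1, fun S _ => hRT.2 S⟩

theorem IsCrucial.nontrivial_subalgebra {J : Ideal R} [J.IsMaximal] (hJ : IsCrucial R J) :
    Nontrivial (Subalgebra (Localization.AtPrime J) (LocExt R J)) := by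
  refine ⟨⊥, ⊤, fun h => hJ ⟨?_, Algebra.surjective_algebraMap_iff.mpr h.symm⟩⟩
  exact localizationAlgebra_injective (M := J.primeCompl) (S := T) _ _ Subtype.val_injective

end Subring

end MinimalExt

theorem theorem3p4 {T : Type*} [CommRing T] [IsDomain T] (R : Subring T)
    (hRT : MinimalExt.IsMinimalRingExtension R)
    (J : Ideal R) [J.IsMaximal] (hJ : MinimalExt.IsCrucial R J) :
    MinimalExt.conductor R = ⊥ ↔
      (MinimalExt.IsMinimalFieldExtension R ∨
        (ValuationRing (Localization.AtPrime J) ∧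
          ringKrullDim (Localization.AtPrime J) = 1 ∧
          IsFractionRing (Localization.AtPrime J) (MinimalExt.LocExt R J))) := by
  have := hRT.isSimpleOrder_subalgebra
  have := hJ.nontrivial_subalgebra
  have hcond := MinimalExt.conductor_eq_bot_iff (R := R)
  by_cases hR : IsField R
  · exact iff_of_true (hcond.mpr (MinimalExt.algebraConductor_eq_bot_of_isField hR))
      (Or.inl (hRT.isMinimalFieldExtension hR))
  have hRJ : ¬ IsField (Localization.AtPrime J) := IsLocalization.AtPrime.not_isField R
    (Ring.ne_bot_of_isMaximal_of_not_isField ‹J.IsMaximal› hR) _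
  have := MinimalExt.isSimpleOrder_subalgebra_of_isLocalization (A := R) (B := T) J.primeCompl
    (Localization.AtPrime J) (MinimalExt.LocExt R J)
  rw [hcond, or_iff_right fun h => hR h.1,
    ← MinimalExt.algebraConductor_eq_bot_iff_of_isLocalization J.primeCompl
      (Localization.AtPrime J) (MinimalExt.LocExt R J) J.primeCompl_le_nonZeroDivisors]
  exact MinimalExt.algebraConductor_eq_bot_iff_of_isLocalRing hRJ
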